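/- Let $q=2^m$ with $m\ge 4$ even, let $\mathrm{GF}(q)\subset\mathrm{GF}(q^2)$ be the finite fields with $q$ and $q^2$ elements, and let $U_{q+1}$ be the set of all $(q+1)$-th roots of unity in $\mathrm{GF}(q^2)$. Let $\mathcal C_{\{3,5\}}$ be the linear code over $\mathrm{GF}(q^2)$, with coordinates indexed by $U_{q+1}$, given by $$\mathcal C_{\{3,5\}}=\left\{\left(a_3u^3+a_{q-2}u^{q-2}+a_5u^5+a_{q-4}u^{q-4}\right)_{u\in U_{q+1}} : a_3,a_{q-2},a_5,a_{q-4}\in\mathrm{GF}(q^2)\right\},$$ and let $$\mathrm{Tr}_{q^2/q}(\mathcal C_{\{3,5\}})=\left\{\left(\mathrm{Tr}_{q^2/q}(c_u)\right)_{u\in U_{q+1}} : (c_u)_{u\in U_{q+1}}\in\mathcal C_{\{3,5\}}\right\}$$ be its trace code over $\mathrm{GF}(q)$, where $\mathrm{Tr}_{q^2/q}$ is the trace map from $\mathrm{GF}(q^2)$ to $\mathrm{GF}(q)$. Let $\mathcal B_{q-4}$ be the set of the supports $\{u\in U_{q+1}: c_u\ne 0\}$ of the codewords $(c_u)_{u\in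 U_{q+1}}$ of Hamming weight $q-4$ in $\mathrm{Tr}_{q^2/q}(\mathcal C_{\{3,5\}})$. A $t$-$(v,k,\lambda)$ design is a pair $(X,\mathcal B)$ of a set $X$ of $v$ points and a set $\mathcal B$ of $k$-subsets of $X$ (blocks) such that any $t$ distinct points are contained in exactly $\lambda$ blocks, where $\lambda$ is a positive integer. The complementary incidence structure of $(X,\mathcal B)$ is $(X,\{X\setminus B: B\in\mathcal B\})$. Then the minimum weight of the nonzero codewords of $\mathrm{Tr}_{q^2/q}(\mathcal C_{\{3,5\}})$ is $q-4$, the number $(q-4)(q-5)(q-6)/60$ is an integer, and $(U_{q+1},\mathcal B_{q-4})$ is a $3$-$(q+1,q-4,\lambda)$ design with $$\lambda=\frac{(q-4)(q-5)(q-6)}{60}.$$ Its complementary incidence structure is a $3$-$(q+1,5,1)$ design. -/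

import Mathlib

namespace TraceCodeDesign

noncomputable instance rootsOfUnityFintype (n : ℕ) (K : Type*) [Field K] :
    Fintype (rootsOfUnity (n + 1) K) :=
  Fintype.ofFinite _

/-- The incidence structure with point set `X` and block set `blocks` is a `t`-`(v, k, lam)`
design: `v` points, all blocks are `k`-subsets, and any `t` points lie in exactly `lam` blocks,
where `lam > 0`. -/
structure IsDesign (t v k lam : ℕ) {X : Type*} [Fintype X] (blocks : Set (Finset X)) : Prop where
  card_points : Fintype.card X = v
  card_block : ∀ B ∈ blocks, B.card = k
  lam_pos : 0 < lam
  card_blocks_through : ∀ T : Finset X, T.card = t → {B ∈ blocks | T ⊆ B}.ncard = lam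

open Classical in
/-- The blocks of the complementary incidence structure: the complements of the blocks. -/
def complementBlocks {X : Type*} [Fintype X] (blocks : Set (Finset X)) : Set (Finset X) :=
  {B | ∃ A ∈ blocks, B = Aᶜ}

open Classical in
/-- The support of a vector. -/
noncomputable def supp {ι F : Type*} [Fintype ι] [Zero F] (c : ι → F) : Finset ι :=
  {i | c i ≠ 0}

open Classical in
/-- The Hamming weight of a vector. -/
noncomputable def wt {ι F : Type*} [Fintype ι] [Zero F] (c : ι → F) : ℕ :=
  hammingNorm c

/-- The set of the supports of the codewords of weight `w` in `C`. -/
def supportBlocks {ι F : Type*} [Fintype ι] [Field F] (C : Submodule F (ι → F)) (w : ℕ) :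
    Set (Finset ι) :=
  {B | ∃ c ∈ C, wt c = w ∧ supp c = B}

/-- `d` is the minimum weight of the nonzero codewords of `C`. -/
def IsMinWeight {ι F : Type*} [Fintype ι] [Field F] (C : Submodule F (ι → F)) (d : ℕ) : Prop :=
  IsLeast {w | ∃ c ∈ C, c ≠ 0 ∧ wt c = w} d

/-- The trace code of a code over `K`: the trace map `K → F` is applied coordinatewise. -/
noncomputable def traceCode (F : Type*) {K ι : Type*} [Field F] [Field K] [Algebra F K]
    (C : Submodule K (ι → K)) : Submodule F (ι → F) :=
  (C.restrictScalars F).map ((Algebra.trace F K).compLeft ι)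

/-- The code of all vectors
`(a₃ u ^ 3 + a_{q-2} u ^ (q-2) + a₅ u ^ 5 + a_{q-4} u ^ (q-4))`, with coordinates indexed by the
`(q+1)`-th roots of unity `u` in `K`, where the four coefficients range over `K`. -/
def code35 (q : ℕ) (K : Type*) [Field K] :
    Submodule K (rootsOfUnity (q + 1) K → K) where
  carrier := {c | ∃ a b a' b' : K, ∀ u : rootsOfUnity (q + 1) K,
    c u = a * ((u : Kˣ) : K) ^ 3 + b * ((u : Kˣ) : K) ^ (q - 2)
      + a' * ((u : Kˣ) : K) ^ 5 + b' * ((u : Kˣ) : K) ^ (q - 4)}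
  zero_mem' := ⟨0, 0, 0, 0, fun u => by simp⟩
  add_mem' := by
    rintro c d ⟨a, b, a', b', hc⟩ ⟨e, f, e', f', hd⟩
    exact ⟨a + e, b + f, a' + e', b' + f', fun u => by rw [Pi.add_apply, hc, hd]; ring⟩
  smul_mem' := by
    rintro r c ⟨a, b, a', b', hc⟩
    exact ⟨r * a, r * b, r * a', r * b', fun u => by
      rw [Pi.smul_apply, hc, smul_eq_mul]; ring⟩

end TraceCodeDesign

/-! Write σ for x ↦ x^q; it inverts every u in U_{q+1}. The trace of a codeword at u, times u^5,
involves only u^10, u^8, u^2 and 1, so in characteristic 2 it is the square of a self-conjugate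
`quintic` γt^5 + αt^4 + σ(α)t + σ(γ). A nonzero word therefore has at most five zeros. The quintic
lacks t^3 and t^2, so five distinct zeros have e₂ = 0, and e₃ = 0 is the conjugate condition.
Conversely, five points of U_{q+1} with e₂ = 0 are the roots of such a quintic
(`exists_quintic_eq_prod`). Given three points, e₂ = e₃ = 0 is a quadratic problem for the other
two. It splits because GF(q) contains a primitive cube root of unity ω when m is even
(`exists_pair_esymmTwo_eq_zero`). Hence the zero sets of size five form a Steiner system S(3, 5,
q+1), and inclusion–exclusion counts their complements through three points. -/

namespace TraceCodeDesign

/-! ### Completing three points of the unit circle to five with e₂ = 0. -/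

section Quintuples

variable {K : Type*} [Field K]

/-- The second elementary symmetric polynomial in five variables. -/
def esymmTwo (x y z w v : K) : K :=
  x * y + x * z + y * z + (x + y + z) * (w + v) + w * v

/-- The third elementary symmetric polynomial in five variables. -/
def esymmThree (x y z w v : K) : K :=
  x * y * z + (x * y + x * z + y * z) * (w + v) + (x + y + z) * (w * v)

/-- The fourth elementary symmetric polynomial in five variables. -/
def esymmFour (x y z w v : K) : K :=
  x * y * z * (w + v) + (x * y + x * z + y * z) * (w * v)

/-- Since σ inverts each point, σ(e₂) = e₃ / e₅. -/
theorem esymmThree_eq_zero (σ : K →+* K) {x y z w v : K} (hx : σ x * x = 1) (hy : σ y * y = 1)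
    (hz : σ z * z = 1) (hw : σ w * w = 1) (hv : σ v * v = 1)
    (h : esymmTwo x y z w v = 0) : esymmThree x y z w v = 0 := by
  have e : esymmThree x y z w v = x * y * z * w * v * σ (esymmTwo x y z w v) := by
    have hx' : σ x = x⁻¹ := eq_inv_of_mul_eq_one_left hx
    have hy' : σ y = y⁻¹ := eq_inv_of_mul_eq_one_left hy
    have hz' : σ z = z⁻¹ := eq_inv_of_mul_eq_one_left hz
    have hw' : σ w = w⁻¹ := eq_inv_of_mul_eq_one_left hw
    have hv' : σ v = v⁻¹ := eq_inv_of_mul_eq_one_left hv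
    have := right_ne_zero_of_mul_eq_one hx
    have := right_ne_zero_of_mul_eq_one hy
    have := right_ne_zero_of_mul_eq_one hz
    have := right_ne_zero_of_mul_eq_one hw
    have := right_ne_zero_of_mul_eq_one hv
    simp only [esymmTwo, esymmThree, map_add, map_mul, hx', hy', hz', hw', hv']
    field_simp
    ring
  rw [e, h, map_zero, mul_zero]

theorem esymmFour_eq (σ : K →+* K) {x y z w v : K} (hx : σ x * x = 1) (hy : σ y * y = 1)
    (hz : σ z * z = 1) (hw : σ w * w = 1) (hv : σ v * v = 1) :
    esymmFour x y z w v = x * y * z * w * v * σ (x + y + z + w + v) := by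
  have hx' : σ x = x⁻¹ := eq_inv_of_mul_eq_one_left hx
  have hy' : σ y = y⁻¹ := eq_inv_of_mul_eq_one_left hy
  have hz' : σ z = z⁻¹ := eq_inv_of_mul_eq_one_left hz
  have hw' : σ w = w⁻¹ := eq_inv_of_mul_eq_one_left hw
  have hv' : σ v = v⁻¹ := eq_inv_of_mul_eq_one_left hv
  have := right_ne_zero_of_mul_eq_one hx
  have := right_ne_zero_of_mul_eq_one hy
  have := right_ne_zero_of_mul_eq_one hz
  have := right_ne_zero_of_mul_eq_one hw
  have := right_ne_zero_of_mul_eq_one hv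
  simp only [esymmFour, map_add, hx', hy', hz', hw', hv']
  field_simp
  ring

/-- The linear form with the coefficients `1, ω, ω ^ 2`. -/
def resolvent (ω x y z : K) : K := x + ω * y + ω ^ 2 * z

/-- The quadratic form conjugate to `resolvent`. -/
def coresolvent (ω x y z : K) : K := y * z + ω * (x * z) + ω ^ 2 * (x * y)

theorem map_resolvent_mul (σ : K →+* K) {ω x y z : K} (hσω : σ ω = ω) (hx : σ x * x = 1)
    (hy : σ y * y = 1) (hz : σ z * z = 1) :
    σ (resolvent ω x y z) * (x * y * z) = coresolvent ω x y z := by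
  simp only [resolvent, coresolvent, map_add, map_mul, map_pow, hσω]
  linear_combination (y * z) * hx + (ω * (x * z)) * hy + (ω ^ 2 * (x * y)) * hz

theorem map_coresolvent (σ : K →+* K) {ω x y z : K} (hσω : σ ω = ω) (hx : σ x * x = 1)
    (hy : σ y * y = 1) (hz : σ z * z = 1) :
    σ (coresolvent ω x y z) * (x * y * z) = resolvent ω x y z := by
  simp only [resolvent, coresolvent, map_add, map_mul, map_pow, hσω]
  linear_combination (x * hy * σ z * z + x * hz) + ω * (y * hx * σ z * z + y * hz)
    + ω ^ 2 * (z * hx * σ y * y + z * hy)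

variable [CharP K 2]

/-- The polynomial `coresolvent + t * resolvent` at t = x. Its values at x, y, z are nonzero for
distinct points, which keeps its root away from all three. -/
theorem coresolvent_add_fst {ω : K} (hω : ω ^ 2 + ω + 1 = 0) (x y z : K) :
    coresolvent ω x y z + x * resolvent ω x y z = (x + y) * (x + z) := by
  have h2 : (2 : K) = 0 := CharTwo.two_eq_zero
  unfold coresolvent resolvent
  grind

theorem coresolvent_add_snd {ω : K} (hω : ω ^ 2 + ω + 1 = 0) (x y z : K) :
   
    coresolvent ω x y z + y * resolvent ω x y z = ω * ((x + y) * (y + z)) := by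
  have h2 : (2 : K) = 0 := CharTwo.two_eq_zero
  unfold coresolvent resolvent
  grind

theorem coresolvent_add_trd {ω : K} (hω : ω ^ 2 + ω + 1 = 0) (x y z : K) :
   
    coresolvent ω x y z + z * resolvent ω x y z = ω ^ 2 * ((x + z) * (y + z)) := by
  have h2 : (2 : K) = 0 := CharTwo.two_eq_zero
  unfold coresolvent resolvent
  grind

theorem sq_add_self_add_one_of_sq {ω : K} (hω : ω ^ 2 + ω + 1 = 0) :
    (ω ^ 2) ^ 2 + ω ^ 2 + 1 = 0 := by
  have h2 : (2 : K) = 0 := CharTwo.two_eq_zero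
  grind

/-- Put B, A for `resolvent`, `coresolvent` at ω, B', A' for those at ω², and p₁, p₂, p₃ for the
symmetric functions of x, y, z. Solving e₂ = e₃ = 0 for the sum and product of the missing pair
gives the quadratic (p₁² + p₂)t² + (p₁p₂ + p₃)t + (p₂² + p₁p₃). This identity and the next two say
that it factors as (tB + A)(tB' + A'). -/
theorem resolvent_mul_resolvent_sq {ω : K} (hω : ω ^ 2 + ω + 1 = 0) (x y z : K) :
    resolvent ω x y z * resolvent (ω ^ 2) x y z
      = (x + y + z) ^ 2 + (x * y + x * z + y * z) := by
  have h2 : (2 : K) = 0 := CharTwo.two_eq_zero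
  unfold resolvent
  grind

theorem coresolvent_mul_coresolvent_sq {ω : K} (hω : ω ^ 2 + ω + 1 = 0) (x y z : K) :
    coresolvent ω x y z * coresolvent (ω ^ 2) x y z
      = (x * y + x * z + y * z) ^ 2 + (x + y + z) * (x * y * z) := by
  have h2 : (2 : K) = 0 := CharTwo.two_eq_zero
  unfold coresolvent
  grind

theorem coresolvent_mul_resolvent_sq_add {ω : K} (hω : ω ^ 2 + ω + 1 = 0) (x y z : K) :
    coresolvent ω x y z * resolvent (ω ^ 2) x y z + coresolvent (ω ^ 2) x y z * resolvent ω x y z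
      = (x + y) * (y + z) * (x + z) := by
  have h2 : (2 : K) = 0 := CharTwo.two_eq_zero
  unfold coresolvent resolvent
  grind

/-- If the resolvent vanished, so would its conjugate and hence the coresolvent, forcing (x + y)(x +
z) = 0. -/
theorem resolvent_ne_zero (σ : K →+* K) {ω x y z : K} (hω : ω ^ 2 + ω + 1 = 0) (hσω : σ ω = ω)
    (hx : σ x * x = 1) (hy : σ y * y = 1) (hz : σ z * z = 1) (hxy : x ≠ y) (hxz : x ≠ z) :
    resolvent ω x y z ≠ 0 := by
  intro h
  have h1 := map_resolvent_mul σ hσω hx hy hz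
  have h2 := coresolvent_add_fst hω x y z
  rw [← h1, h, map_zero, zero_mul, mul_zero, add_zero, eq_comm, mul_eq_zero,
    CharTwo.add_eq_zero, CharTwo.add_eq_zero] at h2
  exact h2.elim hxy hxz

/-- Up to the factor xyz, σ exchanges resolvent and coresolvent, so it inverts their quotient. -/
theorem map_coresolvent_div_mul_self (σ : K →+* K) {ω x y z : K} (hω : ω ^ 2 + ω + 1 = 0)
    (hσω : σ ω = ω) (hx : σ x * x = 1) (hy : σ y * y = 1) (hz : σ z * z = 1) (hxy : x ≠ y)
    (hxz : x ≠ z) :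
    σ (coresolvent ω x y z / resolvent ω x y z) * (coresolvent ω x y z / resolvent ω x y z)
      = 1 := by
  have hB := resolvent_ne_zero σ hω hσω hx hy hz hxy hxz
  have hσB : σ (resolvent ω x y z) ≠ 0 := by simpa using hB
  have h1 := map_resolvent_mul σ hσω hx hy hz
  have h2 := map_coresolvent σ hσω hx hy hz
  rw [map_div₀]
  field_simp
  linear_combination σ (resolvent ω x y z) * h2 - σ (coresolvent ω x y z) * h1

theorem coresolvent_div_ne (σ : K →+* K) {ω x y z : K} (hω : ω ^ 2 + ω + 1 = 0)
    (hσω : σ ω = ω) (hx : σ x * x = 1) (hy : σ y * y = 1) (hz : σ z * z = 1) (hxy : x ≠ y)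
    (hxz : x ≠ z) (hyz : y ≠ z) :
    coresolvent ω x y z / resolvent ω x y z ≠ x ∧ coresolvent ω x y z / resolvent ω x y z ≠ y ∧
      coresolvent ω x y z / resolvent ω x y z ≠ z := by
  have hB := resolvent_ne_zero σ hω hσω hx hy hz hxy hxz
  have hω0 : ω ≠ 0 := by rintro rfl; simp at hω
  have hxy' := mt CharTwo.add_eq_zero.1 hxy
  have hxz' := mt CharTwo.add_eq_zero.1 hxz
  have hyz' := mt CharTwo.add_eq_zero.1 hyz
  have key (t c : K) (hc : coresolvent ω x y z + t * resolvent ω x y z = c) (hc0 : c ≠ 0) :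
      coresolvent ω x y z / resolvent ω x y z ≠ t := by
    intro h
    rw [div_eq_iff hB, ← CharTwo.add_eq_zero, hc] at h
    exact hc0 h
  exact ⟨key x _ (coresolvent_add_fst hω x y z) (mul_ne_zero hxy' hxz'),
    key y _ (coresolvent_add_snd hω x y z) (mul_ne_zero hω0 (mul_ne_zero hxy' hyz')),
    key z _ (coresolvent_add_trd hω x y z)
      (mul_ne_zero (pow_ne_zero 2 hω0) (mul_ne_zero hxz' hyz'))⟩

/-- Three points of the unit circle are completed to a zero of `esymmTwo` by exactly one pair. -/
theorem exists_pair_esymmTwo_eq_zero (σ : K →+* K) {ω x y z : K} (hω : ω ^ 2 + ω + 1 = 0)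
    (hσω : σ ω = ω) (hx : σ x * x = 1) (hy : σ y * y = 1) (hz : σ z * z = 1) (hxy : x ≠ y)
    (hxz : x ≠ z) (hyz : y ≠ z) :
    ∃ w v : K, σ w * w = 1 ∧ σ v * v = 1 ∧ [x, y, z, w, v].Nodup ∧ esymmTwo x y z w v = 0 ∧
      ∀ t s : K, σ t * t = 1 → σ s * s = 1 → esymmTwo x y z t s = 0 → t = w ∨ t = v := by
  have hω' := sq_add_self_add_one_of_sq hω
  have hσω' : σ (ω ^ 2) = ω ^ 2 := by rw [map_pow, hσω]
  have hB := resolvent_ne_zero σ hω hσω hx hy hz hxy hxz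
  have hB' := resolvent_ne_zero σ hω' hσω' hx hy hz hxy hxz
  obtain ⟨hwx, hwy, hwz⟩ := coresolvent_div_ne σ hω hσω hx hy hz hxy hxz hyz
  obtain ⟨hvx, hvy, hvz⟩ := coresolvent_div_ne σ hω' hσω' hx hy hz hxy hxz hyz
  have hBB := resolvent_mul_resolvent_sq hω x y z
  have hAA := coresolvent_mul_coresolvent_sq hω x y z
  have hAB := coresolvent_mul_resolvent_sq_add hω x y z
  have hw := map_coresolvent_div_mul_self σ hω hσω hx hy hz hxy hxz
  have hv := map_coresolvent_div_mul_self σ hω' hσω' hx hy hz hxy hxz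
  generalize resolvent ω x y z = B at *
  generalize resolvent (ω ^ 2) x y z = B' at *
  generalize coresolvent ω x y z = A at *
  generalize coresolvent (ω ^ 2) x y z = A' at *
  have h2 : (2 : K) = 0 := CharTwo.two_eq_zero
  have hxy' := mt CharTwo.add_eq_zero.1 hxy
  have hxz' := mt CharTwo.add_eq_zero.1 hxz
  have hyz' := mt CharTwo.add_eq_zero.1 hyz
  have hsum : A * B' + A' * B ≠ 0 := by
    rw [hAB]; exact mul_ne_zero (mul_ne_zero hxy' hyz') hxz'
  have hwv : A / B ≠ A' / B' := by
    intro h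
    rw [div_eq_div_iff hB hB', ← CharTwo.add_eq_zero] at h
    exact hsum h
  refine ⟨A / B, A' / B', hw, hv, ?_, ?_, ?_⟩
  · simp [hxy, hxz, hyz, hwx.symm, hwy.symm, hwz.symm, hvx.symm, hvy.symm, hvz.symm, hwv]
  · have e : esymmTwo x y z (A / B) (A' / B') * (B * B') = (x * y + x * z + y * z) * (B * B')
        + (x + y + z) * (A * B' + A' * B) + A * A' := by
      unfold esymmTwo
      field_simp
    have : esymmTwo x y z (A / B) (A' / B') * (B * B') = 0 := by
      rw [e, hBB, hAB, hAA]
      linear_combination (x * y + x * z + y * z + (x + y + z) ^ 2) * (x * y + x * z + y * z) * h2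
    exact (mul_eq_zero.1 this).resolve_right (mul_ne_zero hB hB')
  · intro t s ht hs hts
    have h3 := esymmThree_eq_zero σ hx hy hz ht hs hts
    unfold esymmTwo at hts
    unfold esymmThree at h3
    -- Both e₂ and e₃ are affine in s; eliminating s between them leaves the quadratic in t.
    have key : (t * B + A) * (t * B' + A') = 0 := by
      have : (t * B + A) * (t * B' + A') = t ^ 2 * (B * B') + t * (A * B' + A' * B) + A * A' := by
        ring
      rw [this, hBB, hAB, hAA]
      linear_combination (x + y + z + t) * h3
        + (x * y + x * z + y * z + (x + y + z) * t) * hts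
        - ((x + y + z + t) * s * (x * y + x * z + y * z + (x + y + z) * t)
          + (x + y + z) * (x * y + x * z + y * z) * t + x * y * z * t) * h2
    rw [mul_eq_zero, CharTwo.add_eq_zero, CharTwo.add_eq_zero] at key
    rw [eq_div_iff hB, eq_div_iff hB']
    exact key

end Quintuples

/-! ### Self-conjugate quintics and their zeros. -/

section Quintics

open Polynomial

variable {K : Type*} [Field K]

/-- The self-conjugate quintic whose squares describe the codewords. -/
def quintic (σ : K →+* K) (γ α t : K) : K := γ * t ^ 5 + α * t ^ 4 + σ α * t + σ γ

theorem eq_zero_of_card_lt_of_quintic_eq_zero (σ : K →+* K) {γ α : K} (Z : Finset K)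
    (hZ : 5 < Z.card) (h : ∀ t ∈ Z, quintic σ γ α t = 0) : γ = 0 ∧ α = 0 := by
  have hP : (C γ * X ^ 5 + C α * X ^ 4 + C (σ α) * X + C (σ γ) : K[X]) = 0 := by
    refine eq_zero_of_natDegree_lt_card_of_eval_eq_zero' _ Z (fun t ht => ?_)
      (lt_of_le_of_lt (b := 5) (by compute_degree) hZ)
    simpa [quintic] using h t ht
  exact ⟨by simpa [coeff_X, coeff_C] using congrArg (fun P => coeff P 5) hP,
    by simpa [coeff_X, coeff_C] using congrArg (fun P => coeff P 4) hP⟩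

theorem eq_zero_of_card_lt_of_quartic_eq_zero {a b c d e : K} (Z : Finset K) (hZ : 4 < Z.card)
    (h : ∀ t ∈ Z, a * t ^ 4 + b * t ^ 3 + c * t ^ 2 + d * t + e = 0) : a = 0 ∧ b = 0 := by
  have hP : (C a * X ^ 4 + C b * X ^ 3 + C c * X ^ 2 + C d * X + C e : K[X]) = 0 := by
    refine eq_zero_of_natDegree_lt_card_of_eval_eq_zero' _ Z (fun t ht => ?_)
      (lt_of_le_of_lt (b := 4) (by compute_degree) hZ)
    simpa using h t ht
  exact ⟨by simpa [coeff_X, coeff_C] using congrArg (fun P => coeff P 4) hP,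
    by simpa [coeff_X, coeff_C] using congrArg (fun P => coeff P 3) hP⟩

/-- Subtracting γ∏(t - root) leaves degree at most 4 with five zeros, hence zero. The t^3
coefficient gives γe₂ = 0; if γ = 0, the t^4 coefficient gives α = 0. -/
theorem esymmTwo_eq_zero_of_quintic_eq_zero [CharP K 2] (σ : K →+* K) {γ α x y z w v : K}
    (hγα : ¬(γ = 0 ∧ α = 0)) (hd : [x, y, z, w, v].Nodup)
    (h : ∀ t ∈ [x, y, z, w, v], quintic σ γ α t = 0) : esymmTwo x y z w v = 0 := by
  classical
  have h2 : (2 : K) = 0 := CharTwo.two_eq_zero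
  obtain ⟨e4, e3⟩ := eq_zero_of_card_lt_of_quartic_eq_zero (a := α + γ * (x + y + z + w + v))
    (b := γ * esymmTwo x y z w v) (c := γ * esymmThree x y z w v)
    (d := σ α + γ * esymmFour x y z w v) (e := σ γ + γ * (x * y * z * w * v))
    [x, y, z, w, v].toFinset (by rw [List.toFinset_card_of_nodup hd]; simp) (fun t ht => by
      rw [List.mem_toFinset] at ht
      have h1 := h t ht
      have h3 : (t - x) * (t - y) * (t - z) * (t - w) * (t - v) = 0 := by
        simp only [List.mem_cons, List.not_mem_nil, or_false] at ht
        rcases ht with rfl | rfl | rfl | rfl | rfl <;> simp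
      unfold quintic at h1
      unfold esymmTwo esymmThree esymmFour
      linear_combination h1 - γ * h3
        + γ * (t ^ 3 * (x * y + x * z + y * z + (x + y + z) * (w + v) + w * v)
          + t * (x * y * z * (w + v) + (x * y + x * z + y * z) * (w * v))) * h2)
  refine (mul_eq_zero.1 e3).resolve_left fun h0 => hγα ⟨h0, ?_⟩
  simpa [h0] using e4

/-- A zero of `esymmTwo` on the unit circle is the zero set of a self-conjugate quintic. -/
theorem exists_quintic_eq_prod [CharP K 2] (σ : K →+* K) {x y z w v : K} (hx : σ x * x = 1)
    (hy : σ y * y = 1) (hz : σ z * z = 1) (hw : σ w * w = 1) (hv : σ v * v = 1)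
    (h : esymmTwo x y z w v = 0) : ∃ γ α : K, γ ≠ 0 ∧
      ∀ t, quintic σ γ α t = γ * ((t - x) * (t - y) * (t - z) * (t - w) * (t - v)) := by
  have h2 : (2 : K) = 0 := CharTwo.two_eq_zero
  have h3 := esymmThree_eq_zero σ hx hy hz hw hv h
  have h4 := esymmFour_eq σ hx hy hz hw hv
  -- Hilbert 90 for the norm-one element e = xyzwv: γ = 1 + σ(e) works unless e = 1, when it
  -- vanishes and γ = 1 serves.
  obtain ⟨γ, hγ, hσγ⟩ : ∃ γ : K, γ ≠ 0 ∧ σ γ = γ * (x * y * z * w * v) := by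
    have he : σ (x * y * z * w * v) * (x * y * z * w * v) = 1 := by
      simp only [map_mul]
      calc _ = (σ x * x) * (σ y * y) * (σ z * z) * (σ w * w) * (σ v * v) := by ring
        _ = 1 := by rw [hx, hy, hz, hw, hv]; ring
    generalize x * y * z * w * v = e at he
    by_cases h1 : e = 1
    · exact ⟨1, one_ne_zero, by simp [h1]⟩
    · refine ⟨1 + σ e, fun h0 => ?_, ?_⟩
      · have : σ e = 1 := (CharTwo.add_eq_zero.1 h0).symm
        rw [this, one_mul] at he
        exact h1 he
      · have he' : σ (σ e) * σ e = 1 := by rw [← map_mul, he, map_one]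
        have h0 := left_ne_zero_of_mul_eq_one he
        have : σ (σ e) = e := mul_right_cancel₀ h0 (by rw [he', mul_comm, he])
        rw [map_add, map_one, this]
        linear_combination -he
  -- With α = γe₁, the relation e₄ = e₅σ(e₁) makes the coefficient of t equal to σ(α).
  refine ⟨γ, γ * (x + y + z + w + v), hγ, fun t => ?_⟩
  unfold quintic
  rw [map_mul, hσγ]
  unfold esymmTwo at h
  unfold esymmThree at h3
  unfold esymmFour at h4
  linear_combination γ * (-t * h4 - t ^ 3 * h + t ^ 2 * h3) + γ * (x * y * z * w * v
    + t ^ 4 * (x + y + z + w + v)) * h2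

end Quintics

/-! ### Block counts in a Steiner system S(3, 5, v). -/

section Counting

variable {X : Type*} [Fintype X]

open Classical in
/-- Counting the pairs of a block through `S` and a point of that block outside `S`. -/
theorem card_filter_superset_mul (𝓑 : Finset (Finset X)) {k μ : ℕ} (hk : ∀ B ∈ 𝓑, B.card = k)
    (S : Finset X)
    (h : ∀ x ∉ S, (𝓑.filter fun B => insert x S ⊆ B).card = μ) :
    (𝓑.filter fun B => S ⊆ B).card * (k - S.card) = (Fintype.card X - S.card) * μ := by
  have h1 := Finset.sum_card_bipartiteAbove_eq_sum_card_bipartiteBelow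
    (s := 𝓑.filter fun B => S ⊆ B) (t := Sᶜ) (fun B x => x ∈ B)
  rw [Finset.sum_const_nat (m := k - S.card), Finset.sum_const_nat (m := μ)] at h1
  · rw [h1, Finset.card_compl]
  · intro x hx
    rw [← h x (Finset.mem_compl.1 hx)]
    congr 1
    ext B
    simp [Finset.bipartiteBelow, Finset.insert_subset_iff]
    tauto
  · intro B hB
    obtain ⟨hB, hS⟩ := Finset.mem_filter.1 hB
    rw [← hk B hB, ← Finset.card_sdiff_of_subset hS]
    congr 1
    ext x
    simp [Finset.bipartiteAbove, and_comm]

open Classical in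
/-- In a `3`-`(v, 5, 1)` design exactly `(v-5)(v-6)(v-7)/60` blocks avoid three given points. -/
theorem card_filter_disjoint_of_steiner (𝓑 : Finset (Finset X)) (hk : ∀ B ∈ 𝓑, B.card = 5)
    (h3 : ∀ T : Finset X, T.card = 3 → (𝓑.filter fun B => T ⊆ B).card = 1)
    (hv : 7 ≤ Fintype.card X) {T : Finset X} (hT : T.card = 3) :
    60 * (𝓑.filter fun B => Disjoint T B).card
      = (Fintype.card X - 5) * (Fintype.card X - 6) * (Fintype.card X - 7) := by
  obtain ⟨n, hn⟩ := Nat.exists_eq_add_of_le hv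
  have c2 : ∀ S : Finset X, S.card = 2 → 3 * (𝓑.filter fun B => S ⊆ B).card = n + 5 := by
    intro S hS
    have := card_filter_superset_mul 𝓑 hk S (μ := 1)
      (fun x hx => h3 _ (by rw [Finset.card_insert_of_notMem hx, hS]))
    rw [hS, hn] at this
    omega
  have c1 : ∀ S : Finset X, S.card = 1 → 12 * (𝓑.filter fun B => S ⊆ B).card
      = (n + 6) * (n + 5) := by
    intro S hS
    have := card_filter_superset_mul 𝓑 hk S (μ := (n + 5) / 3) (fun x hx => by
      have := c2 (insert x S) (by rw [Finset.card_insert_of_notMem hx, hS])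
      omega)
    -- The quotient in μ is exact: the pair count itself supplies the divisibility.
    obtain ⟨a, ha⟩ : ∃ a, n + 5 = 3 * a := by
      obtain ⟨S', -, hS'⟩ := Finset.exists_subset_card_eq
        (show 2 ≤ (Finset.univ : Finset X).card by rw [Finset.card_univ]; omega)
      exact ⟨_, (c2 S' hS').symm⟩
    rw [hS, hn, ha, Nat.mul_div_cancel_left _ (by norm_num)] at this
    rw [ha]
    have e : 7 + n - 1 = n + 6 := by omega
    rw [e] at this
    linarith
  have c0 : 60 * 𝓑.card = (n + 7) * ((n + 6) * (n + 5)) := by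
    obtain ⟨a, ha⟩ : ∃ a, (n + 6) * (n + 5) = 12 * a := by
      obtain ⟨S', -, hS'⟩ := Finset.exists_subset_card_eq
        (show 1 ≤ (Finset.univ : Finset X).card by rw [Finset.card_univ]; omega)
      exact ⟨_, (c1 S' hS').symm⟩
    have := card_filter_superset_mul 𝓑 hk ∅ (μ := a) (fun x hx => by
      have := c1 (insert x ∅) (by simp)
      omega)
    simp [hn] at this
    rw [ha]
    linarith
  obtain ⟨x, y, z, hxy, hxz, hyz, rfl⟩ := Finset.card_eq_three.1 hT
  have s (S : Finset X) : ((𝓑.filter fun B => S ⊆ B).card : ℤ)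
      = ∑ B ∈ 𝓑, if S ⊆ B then 1 else 0 := by
    rw [Finset.card_filter]; push_cast; rfl
  -- Inclusion–exclusion over the three points, in ℤ to avoid truncated subtraction.
  have hd : ((𝓑.filter fun B => Disjoint {x, y, z} B).card : ℤ) = 𝓑.card
      - (𝓑.filter fun B => {x} ⊆ B).card - (𝓑.filter fun B => {y} ⊆ B).card
      - (𝓑.filter fun B => {z} ⊆ B).card + (𝓑.filter fun B => {x, y} ⊆ B).card
      + (𝓑.filter fun B => {x, z} ⊆ B).card + (𝓑.filter fun B => {y, z} ⊆ B).card
      - (𝓑.filter fun B => {x, y, z} ⊆ B).card := by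
    rw [s, s, s, s, s, s, s, Finset.card_filter, Finset.card_eq_sum_ones]
    push_cast
    simp only [← Finset.sum_sub_distrib, ← Finset.sum_add_distrib]
    refine Finset.sum_congr rfl fun B _ => ?_
    simp only [Finset.insert_subset_iff, Finset.singleton_subset_iff,
      Finset.disjoint_insert_left, Finset.disjoint_singleton_left]
    by_cases hx : x ∈ B <;> by_cases hy : y ∈ B <;> by_cases hz : z ∈ B <;> simp [hx, hy, hz]
  have e1 := h3 _ hT
  have e2 := c2 _ (Finset.card_pair hxy)
  have e3 := c2 _ (Finset.card_pair hxz)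
  have e4 := c2 _ (Finset.card_pair hyz)
  have e5 := c1 _ (Finset.card_singleton x)
  have e6 := c1 _ (Finset.card_singleton y)
  have e7 := c1 _ (Finset.card_singleton z)
  rw [hn, show 7 + n - 5 = n + 2 by omega, show 7 + n - 6 = n + 1 by omega,
    show 7 + n - 7 = n by omega]
  zify at *
  rw [hd]
  linarith

end Counting

/-! ### Roots of unity and the trace in finite fields. -/

section FiniteFields

variable {K : Type*} [Field K] [Finite K]

theorem exists_isPrimitiveRoot_of_dvd {n : ℕ} (h : n ∣ Nat.card K - 1) :
    ∃ ζ : K, IsPrimitiveRoot ζ n := by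
  have hpos : 0 < Nat.card Kˣ := Nat.card_pos
  obtain ⟨g, hg⟩ := IsCyclic.exists_ofOrder_eq_natCard (α := Kˣ)
  have hp : IsPrimitiveRoot (g : K) (Nat.card Kˣ) := by
    rw [IsPrimitiveRoot.coe_units_iff, ← hg]
    exact IsPrimitiveRoot.orderOf g
  rw [← Nat.card_units] at h
  obtain ⟨a, ha⟩ := h
  exact ⟨_, hp.pow hpos (by rw [ha, mul_comm])⟩

theorem charP_two_of_natCard_eq_two_pow {n : ℕ} (h : Nat.card K = 2 ^ n) : CharP K 2 := by
  have := Fintype.ofFinite K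
  have h0 : ((Nat.card K : ℕ) : K) = 0 := by
    rw [Nat.card_eq_fintype_card]
    exact FiniteField.cast_card_eq_zero K
  rw [h, Nat.cast_pow] at h0
  exact CharTwo.of_one_ne_zero_of_two_eq_zero one_ne_zero (by simpa using eq_zero_of_pow_eq_zero h0)

theorem natCard_rootsOfUnity_of_natCard_eq_sq {q : ℕ} (hK : Nat.card K = q ^ 2) :
    Nat.card (rootsOfUnity (q + 1) K) = q + 1 := by
  obtain ⟨ζ, hζ⟩ := exists_isPrimitiveRoot_of_dvd (K := K) (n := q + 1)
    ⟨q - 1, by rw [hK, ← Nat.sq_sub_sq, one_pow]⟩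
  exact hζ.card_rootsOfUnity

theorem three_dvd_two_pow_sub_one {m : ℕ} (hm : Even m) : 3 ∣ 2 ^ m - 1 := by
  obtain ⟨k, rfl⟩ := hm
  rw [← two_mul, pow_mul]
  simpa using Nat.sub_dvd_pow_sub_pow 4 1 k

/-- Evenness of m enters here through 3 ∣ q - 1: it makes ω fixed by x ↦ x^q. -/
theorem exists_sq_add_self_add_one_eq_zero {q : ℕ} (h3 : 3 ∣ q - 1) (hq : 0 < q)
    (hK : Nat.card K = q ^ 2) : ∃ ω : K, ω ^ 2 + ω + 1 = 0 ∧ ω ^ q = ω := by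
  obtain ⟨ω, hω⟩ := exists_isPrimitiveRoot_of_dvd (K := K) (n := 3) (h3.trans
    ⟨q + 1, by rw [hK, mul_comm, ← Nat.sq_sub_sq, one_pow]⟩)
  refine ⟨ω, ?_, ?_⟩
  · have := hω.geom_sum_eq_zero (by norm_num)
    simp [Finset.sum_range_succ] at this
    linear_combination this
  · obtain ⟨k, hk⟩ := h3
    obtain rfl : q = 3 * k + 1 := by omega
    rw [pow_succ, pow_mul, hω.pow_eq_one, one_pow, one_mul]

theorem algebraMap_trace_eq_add_pow {F : Type*} [Field F] [Algebra F K] {q : ℕ} (hq : 1 < q)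
    (hF : Nat.card F = q) (hK : Nat.card K = q ^ 2) (x : K) :
    algebraMap F K (Algebra.trace F K x) = x + x ^ q := by
  have hr : Module.finrank F K = 2 := by
    have := Module.natCard_eq_pow_finrank (K := F) (V := K)
    rw [hF, hK] at this
    exact (Nat.pow_right_injective hq this).symm
  rw [FiniteField.algebraMap_trace_eq_sum_pow, hr, hF]
  simp [Finset.sum_range_succ]

end FiniteFields

/-! ### Codewords of the trace code as squares of quintics. -/

section Codewords

variable {K : Type*} [Field K]

theorem coe_rootsOfUnity_injective (n : ℕ) :
    Function.Injective fun u : rootsOfUnity n K => ((u : Kˣ) : K) :=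
  Units.val_injective.comp Subtype.val_injective

theorem coe_rootsOfUnity_pow {n : ℕ} (u : rootsOfUnity n K) : ((u : Kˣ) : K) ^ n = 1 := by
  rw [← Units.val_pow_eq_pow_val, (mem_rootsOfUnity n (u : Kˣ)).1 u.2, Units.val_one]

theorem map_mul_self_eq_one_iff {q : ℕ} {σ : K →+* K} (hσ : ∀ x, σ x = x ^ q) (t : K) :
    σ t * t = 1 ↔ ∃ u : rootsOfUnity (q + 1) K, ((u : Kˣ) : K) = t := by
  rw [hσ, ← pow_succ]
  constructor
  · intro h
    exact ⟨rootsOfUnity.mkOfPowEq t h, rootsOfUnity.val_mkOfPowEq_coe t h⟩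
  · rintro ⟨u, rfl⟩
    exact coe_rootsOfUnity_pow u

variable [Finite K] [CharP K 2] {F : Type*} [Field F] [Algebra F K] {q : ℕ} {σ : K →+* K}

/-- On U_{q+1} the exponents q - 2 and q - 4 mean -3 and -5, and the conjugate of u is its inverse.
The trace thus merges a with σ(b) and a' with σ(b'); after multiplication by u^5 all exponents are
even. -/
theorem algebraMap_trace_mul_pow_five (hq : 4 ≤ q) (hF : Nat.card F = q)
    (hK : Nat.card K = q ^ 2) (hσ : ∀ x, σ x = x ^ q) {a b a' b' γ α : K}
    (hα : a + σ b = α ^ 2) (hγ : a' + σ b' = γ ^ 2) (u : rootsOfUnity (q + 1) K) :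
    algebraMap F K (Algebra.trace F K (a * ((u : Kˣ) : K) ^ 3 + b * ((u : Kˣ) : K) ^ (q - 2)
        + a' * ((u : Kˣ) : K) ^ 5 + b' * ((u : Kˣ) : K) ^ (q - 4))) * ((u : Kˣ) : K) ^ 5
      = quintic σ γ α ((u : Kˣ) : K) ^ 2 := by
  have := Fintype.ofFinite K
  have hσσ (x : K) : σ (σ x) = x := by
    rw [hσ, hσ, ← pow_mul, ← sq, ← hK, Nat.card_eq_fintype_card, FiniteField.pow_card]
  have hu := (map_mul_self_eq_one_iff hσ _).2 ⟨u, rfl⟩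
  have hu1 := coe_rootsOfUnity_pow u
  have hα' : σ a + b = σ α ^ 2 := by rw [← map_pow, ← hα, map_add, hσσ]
  have hγ' : σ a' + b' = σ γ ^ 2 := by rw [← map_pow, ← hγ, map_add, hσσ]
  generalize ((u : Kˣ) : K) = t at *
  have ht : t ≠ 0 := right_ne_zero_of_mul_eq_one hu
  have hu' : σ t = t⁻¹ := eq_inv_of_mul_eq_one_left hu
  have e1 : t ^ (q - 2) = t⁻¹ ^ 3 := by
    rw [inv_pow, ← mul_eq_one_iff_eq_inv₀ (pow_ne_zero 3 ht), ← pow_add,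
      show q - 2 + 3 = q + 1 by omega, hu1]
  have e2 : t ^ (q - 4) = t⁻¹ ^ 5 := by
    rw [inv_pow, ← mul_eq_one_iff_eq_inv₀ (pow_ne_zero 5 ht), ← pow_add,
      show q - 4 + 5 = q + 1 by omega, hu1]
  rw [algebraMap_trace_eq_add_pow (by omega) hF hK, ← hσ, e1, e2]
  simp only [map_add, map_mul, map_pow, map_inv₀, hu', inv_inv]
  unfold quintic
  rw [CharTwo.add_sq, CharTwo.add_sq, CharTwo.add_sq, mul_pow, mul_pow, mul_pow, ← hα, ← hγ,
    ← hα', ← hγ']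
  field_simp
  ring

/-- The codewords of the trace code are, up to a nonvanishing factor, squares of self-conjugate
quintics. -/
theorem exists_quintic_of_mem_traceCode (hq : 4 ≤ q) (hF : Nat.card F = q)
    (hK : Nat.card K = q ^ 2) (hσ : ∀ x, σ x = x ^ q) {d : rootsOfUnity (q + 1) K → F}
    (hd : d ∈ traceCode F (code35 q K)) : ∃ γ α : K, ∀ u : rootsOfUnity (q + 1) K,
      algebraMap F K (d u) * ((u : Kˣ) : K) ^ 5 = quintic σ γ α ((u : Kˣ) : K) ^ 2 := by
  obtain ⟨c, ⟨a, b, a', b', hc⟩, rfl⟩ := hd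
  obtain ⟨α, hα⟩ := isSquare_of_charTwo' (a + σ b)
  obtain ⟨γ, hγ⟩ := isSquare_of_charTwo' (a' + σ b')
  refine ⟨γ, α, fun u => ?_⟩
  rw [← algebraMap_trace_mul_pow_five hq hF hK hσ (by rw [hα, sq]) (by rw [hγ, sq]) u, ← hc]
  rfl

theorem exists_mem_traceCode_of_quintic (hq : 4 ≤ q) (hF : Nat.card F = q)
    (hK : Nat.card K = q ^ 2) (hσ : ∀ x, σ x = x ^ q) (γ α : K) :
    ∃ d ∈ traceCode F (code35 q K), ∀ u : rootsOfUnity (q + 1) K,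
      algebraMap F K (d u) * ((u : Kˣ) : K) ^ 5 = quintic σ γ α ((u : Kˣ) : K) ^ 2 :=
  ⟨_, ⟨_, ⟨α ^ 2, 0, γ ^ 2, 0, fun _ => rfl⟩, rfl⟩, fun u =>
    algebraMap_trace_mul_pow_five hq hF hK hσ (by simp) (by simp) u⟩

end Codewords

/-! ### Zero sets of codewords. -/

section Zeros

variable {K : Type*} [Field K] {F : Type*} [Field F] [Algebra F K] {q : ℕ} {σ : K →+* K}

theorem eq_zero_iff_quintic_eq_zero {γ α : K} {d : rootsOfUnity (q + 1) K → F}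
    (h : ∀ u : rootsOfUnity (q + 1) K,
      algebraMap F K (d u) * ((u : Kˣ) : K) ^ 5 = quintic σ γ α ((u : Kˣ) : K) ^ 2)
    (u : rootsOfUnity (q + 1) K) : d u = 0 ↔ quintic σ γ α ((u : Kˣ) : K) = 0 := by
  rw [← pow_eq_zero_iff (a := quintic σ γ α _) two_ne_zero, ← h u, mul_eq_zero,
    or_iff_left (pow_ne_zero 5 (Units.ne_zero _)), map_eq_zero]

theorem not_and_eq_zero_of_ne_zero {γ α : K} {d : rootsOfUnity (q + 1) K → F}
    (h : ∀ u : rootsOfUnity (q + 1) K,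
      algebraMap F K (d u) * ((u : Kˣ) : K) ^ 5 = quintic σ γ α ((u : Kˣ) : K) ^ 2)
    (hd : d ≠ 0) : ¬(γ = 0 ∧ α = 0) := by
  rintro ⟨rfl, rfl⟩
  exact hd (funext fun u => (eq_zero_iff_quintic_eq_zero h u).2 (by simp [quintic]))

variable [Finite K] [CharP K 2]

theorem card_le_five_of_mem_traceCode (hq : 4 ≤ q) (hF : Nat.card F = q)
    (hK : Nat.card K = q ^ 2) (hσ : ∀ x, σ x = x ^ q) {d : rootsOfUnity (q + 1) K → F}
    (hd : d ∈ traceCode F (code35 q K)) (hd0 : d ≠ 0) (Z : Finset (rootsOfUnity (q + 1) K))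
    (hZ : ∀ u ∈ Z, d u = 0) : Z.card ≤ 5 := by
  classical
  obtain ⟨γ, α, h⟩ := exists_quintic_of_mem_traceCode hq hF hK hσ hd
  by_contra! hlt
  rw [← Finset.card_image_of_injective Z (coe_rootsOfUnity_injective (q + 1))] at hlt
  refine not_and_eq_zero_of_ne_zero h hd0 (eq_zero_of_card_lt_of_quintic_eq_zero σ _ hlt ?_)
  intro t ht
  obtain ⟨u, hu, rfl⟩ := Finset.mem_image.1 ht
  exact (eq_zero_iff_quintic_eq_zero h u).1 (hZ u hu)

theorem esymmTwo_eq_zero_of_mem_traceCode (hq : 4 ≤ q) (hF : Nat.card F = q)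
    (hK : Nat.card K = q ^ 2) (hσ : ∀ x, σ x = x ^ q) {d : rootsOfUnity (q + 1) K → F}
    (hd : d ∈ traceCode F (code35 q K)) (hd0 : d ≠ 0) {x y z w v : rootsOfUnity (q + 1) K}
    (hn : [x, y, z, w, v].Nodup) (hZ : ∀ u ∈ [x, y, z, w, v], d u = 0) :
    esymmTwo ((x : Kˣ) : K) ((y : Kˣ) : K) ((z : Kˣ) : K) ((w : Kˣ) : K) ((v : Kˣ) : K) = 0 := by
  obtain ⟨γ, α, h⟩ := exists_quintic_of_mem_traceCode hq hF hK hσ hd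
  refine esymmTwo_eq_zero_of_quintic_eq_zero σ (not_and_eq_zero_of_ne_zero h hd0)
    (hn.map (coe_rootsOfUnity_injective (q + 1))) ?_
  intro t ht
  obtain ⟨u, hu, rfl⟩ := List.mem_map.1 (show t ∈ [x, y, z, w, v].map fun u : rootsOfUnity (q + 1) K =>
    ((u : Kˣ) : K) from ht)
  exact (eq_zero_iff_quintic_eq_zero h u).1 (hZ u hu)

theorem exists_mem_traceCode_of_esymmTwo_eq_zero (hq : 4 ≤ q) (hF : Nat.card F = q)
    (hK : Nat.card K = q ^ 2) (hσ : ∀ x, σ x = x ^ q) {x y z w v : rootsOfUnity (q + 1) K}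
    (h : esymmTwo ((x : Kˣ) : K) ((y : Kˣ) : K) ((z : Kˣ) : K) ((w : Kˣ) : K) ((v : Kˣ) : K) = 0) :
    ∃ d ∈ traceCode F (code35 q K), ∀ u, d u = 0 ↔ u ∈ [x, y, z, w, v] := by
  have hU (u : rootsOfUnity (q + 1) K) := (map_mul_self_eq_one_iff hσ _).2 ⟨u, rfl⟩
  obtain ⟨γ, α, hγ, hprod⟩ := exists_quintic_eq_prod σ (hU x) (hU y) (hU z) (hU w) (hU v) h
  obtain ⟨d, hd, hdu⟩ := exists_mem_traceCode_of_quintic (F := F) hq hF hK hσ γ α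
  refine ⟨d, hd, fun u => ?_⟩
  rw [eq_zero_iff_quintic_eq_zero hdu, hprod]
  simp [hγ, sub_eq_zero, or_assoc, Units.val_inj, SetLike.coe_eq_coe]

-- Passes from supports of words of weight w to zero sets of size k; w > 0 makes such words nonzero.
open Classical in
theorem mem_complementBlocks_supportBlocks_iff {ι F : Type*} [Fintype ι] [Field F]
    (C : Submodule F (ι → F)) {k w : ℕ} (hw : w + k = Fintype.card ι) (hw0 : 0 < w)
    (B : Finset ι) : B ∈ complementBlocks (supportBlocks C w) ↔
      B.card = k ∧ ∃ d ∈ C, d ≠ 0 ∧ ∀ u, d u = 0 ↔ u ∈ B := by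
  constructor
  · rintro ⟨A, ⟨d, hd, hdw, rfl⟩, rfl⟩
    have hc : (supp d).card = w := hdw
    refine ⟨by rw [Finset.card_compl, hc]; omega, d, hd, ?_, fun u => by simp [supp]⟩
    rintro rfl
    simp [supp] at hc
    omega
  · rintro ⟨hB, d, hd, -, h⟩
    have hs : supp d = Bᶜ := by ext u; simp [supp, h]
    refine ⟨Bᶜ, ⟨d, hd, ?_, hs⟩, by simp⟩
    change (supp d).card = w
    rw [hs, Finset.card_compl]
    omega

/-- Any three points lie in exactly one zero set of size five of a nonzero codeword. -/
theorem existsUnique_zeros_superset (hq : 5 ≤ q) (hF : Nat.card F = q)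
    (hK : Nat.card K = q ^ 2) (h3 : 3 ∣ q - 1) (hσ : ∀ x, σ x = x ^ q)
    {T : Finset (rootsOfUnity (q + 1) K)} (hT : T.card = 3) :
    ∃! B : Finset (rootsOfUnity (q + 1) K), (B.card = 5 ∧
      ∃ d ∈ traceCode F (code35 q K), d ≠ 0 ∧ ∀ u, d u = 0 ↔ u ∈ B) ∧ T ⊆ B := by
  classical
  obtain ⟨x, y, z, hxy, hxz, hyz, rfl⟩ := Finset.card_eq_three.1 hT
  have hU (u : rootsOfUnity (q + 1) K) := (map_mul_self_eq_one_iff hσ _).2 ⟨u, rfl⟩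
  have hinj := coe_rootsOfUnity_injective (K := K) (q + 1)
  obtain ⟨ω, hω, hωq⟩ := exists_sq_add_self_add_one_eq_zero h3 (by omega) hK
  obtain ⟨w', v', hw', hv', hn, he, huniq⟩ := exists_pair_esymmTwo_eq_zero σ hω
    ((hσ ω).trans hωq) (hU x) (hU y) (hU z) (hinj.ne hxy) (hinj.ne hxz) (hinj.ne hyz)
  obtain ⟨w, rfl⟩ := (map_mul_self_eq_one_iff hσ _).1 hw'
  obtain ⟨v, rfl⟩ := (map_mul_self_eq_one_iff hσ _).1 hv'
  have hn' : [x, y, z, w, v].Nodup :=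
    List.Nodup.of_map (fun u : rootsOfUnity (q + 1) K => ((u : Kˣ) : K)) hn
  have hcard : [x, y, z, w, v].toFinset.card = 5 := List.toFinset_card_of_nodup hn'
  obtain ⟨d, hd, hdz⟩ := exists_mem_traceCode_of_esymmTwo_eq_zero (F := F) (by omega) hF hK hσ he
  refine ⟨[x, y, z, w, v].toFinset, ⟨⟨hcard, d, hd, ?_, fun u => by rw [hdz, List.mem_toFinset]⟩,
    by simp [Finset.insert_subset_iff]⟩, ?_⟩
  -- The zero word would vanish at all q + 1 > 5 points.
  · rintro rfl
    have h1 : (Finset.univ : Finset (rootsOfUnity (q + 1) K)) ⊆ [x, y, z, w, v].toFinset :=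
      fun u _ => List.mem_toFinset.2 ((hdz u).1 rfl)
    have h2 := Finset.card_le_card h1
    rw [hcard, Finset.card_univ, ← Nat.card_eq_fintype_card,
      natCard_rootsOfUnity_of_natCard_eq_sq hK] at h2
    omega
  · rintro B ⟨⟨hB, d', hd', hd0, hdB⟩, hTB⟩
    have hsd : (B \ {x, y, z}).card = 2 := by rw [Finset.card_sdiff_of_subset hTB, hB, hT]
    obtain ⟨t, s, hts, hBts⟩ := Finset.card_eq_two.1 hsd
    have ht : t ∈ B \ {x, y, z} := by rw [hBts]; simp
    have hs : s ∈ B \ {x, y, z} := by rw [hBts]; simp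
    simp only [Finset.mem_sdiff, Finset.mem_insert, Finset.mem_singleton, not_or] at ht hs
    simp only [Finset.insert_subset_iff, Finset.singleton_subset_iff] at hTB
    have hnts : [x, y, z, t, s].Nodup := by
      simp [hxy, hxz, hyz, hts, Ne.symm ht.2.1, Ne.symm ht.2.2.1, Ne.symm ht.2.2.2,
        Ne.symm hs.2.1, Ne.symm hs.2.2.1, Ne.symm hs.2.2.2]
    -- Uniqueness constrains only the fourth argument, so the pair is used in both orders.
    have hnst : [x, y, z, s, t].Nodup := by
      simp [hxy, hxz, hyz, hts.symm, Ne.symm ht.2.1, Ne.symm ht.2.2.1, Ne.symm ht.2.2.2,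
        Ne.symm hs.2.1, Ne.symm hs.2.2.1, Ne.symm hs.2.2.2]
    have e1 := esymmTwo_eq_zero_of_mem_traceCode (by omega) hF hK hσ hd' hd0 hnts
      (by simp [hdB, hTB, ht.1, hs.1])
    have e2 := esymmTwo_eq_zero_of_mem_traceCode (by omega) hF hK hσ hd' hd0 hnst
      (by simp [hdB, hTB, ht.1, hs.1])
    have t1 := huniq _ _ (hU t) (hU s) e1
    have t2 := huniq _ _ (hU s) (hU t) e2
    rw [hinj.eq_iff, hinj.eq_iff] at t1 t2
    refine Finset.eq_of_subset_of_card_le (fun u hu => ?_) (by rw [hB, hcard])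
    have hu' : u ∈ [x, y, z, w, v] := by
      by_cases h : u ∈ ({x, y, z} : Finset (rootsOfUnity (q + 1) K))
      · simp only [Finset.mem_insert, Finset.mem_singleton] at h
        rcases h with h | h | h <;> simp [h]
      · have : u ∈ B \ {x, y, z} := Finset.mem_sdiff.2 ⟨hu, h⟩
        rw [hBts, Finset.mem_insert, Finset.mem_singleton] at this
        rcases this with rfl | rfl
        · rcases t1 with h | h <;> simp [h]
        · rcases t2 with h | h <;> simp [h]
    exact List.mem_toFinset.2 hu'

end Zeros

/-! ### From the Steiner system to the design of supports and the minimum weight. -/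

/-- A Steiner system `S(3, 5, v)` and the system of the complements of its blocks. -/
theorem isDesign_of_isDesign_complementBlocks {X : Type*} [Fintype X] {v k : ℕ}
    {blocks : Set (Finset X)} (hv : 8 ≤ v) (hk : v = k + 5) (hb : ∀ B ∈ blocks, B.card = k)
    (h : IsDesign 3 v 5 1 (complementBlocks blocks)) :
    60 ∣ k * (k - 1) * (k - 2) ∧ IsDesign 3 v k (k * (k - 1) * (k - 2) / 60) blocks := by
  classical
  -- A block contains T exactly when its complement is disjoint from T.
  have hcount (T : Finset X) (hT : T.card = 3) :
      60 * {B ∈ blocks | T ⊆ B}.ncard = k * (k - 1) * (k - 2) := by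
    have := card_filter_disjoint_of_steiner (complementBlocks blocks).toFinset
      (fun B hB => h.card_block B (Set.mem_toFinset.1 hB)) (fun T hT => by
        rw [← h.card_blocks_through T hT, ← Set.ncard_coe_finset]
        congr 1
        ext B
        simp) (by rw [h.card_points]; omega) hT
    rw [h.card_points, hk, show k + 5 - 5 = k by omega, show k + 5 - 6 = k - 1 by omega,
      show k + 5 - 7 = k - 2 by omega] at this
    rw [← this, ← Set.ncard_coe_finset, ← Set.ncard_image_of_injective _ compl_injective]
    congr 2
    ext B
    simp only [Set.mem_image, Set.mem_ofPred_eq, Finset.coe_filter, Set.mem_toFinset]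
    constructor
    · rintro ⟨A, ⟨hA, hTA⟩, rfl⟩
      exact ⟨⟨A, hA, by congr⟩, disjoint_compl_right_iff.2 hTA⟩
    · rintro ⟨⟨A, hA, rfl⟩, hTA⟩
      exact ⟨A, ⟨hA, disjoint_compl_right_iff.1 (by convert hTA)⟩, by congr⟩
  obtain ⟨T, -, hT⟩ := Finset.exists_subset_card_eq
    (show 3 ≤ (Finset.univ : Finset X).card by rw [Finset.card_univ, h.card_points]; omega)
  have hpos : 0 < k * (k - 1) * (k - 2) :=
    Nat.mul_pos (Nat.mul_pos (by omega) (by omega)) (by omega)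
  have hT' := hcount T hT
  refine ⟨⟨_, hT'.symm⟩, h.card_points, hb, by omega, fun T hT => ?_⟩
  have := hcount T hT
  omega

end TraceCodeDesign

theorem mainTheorem7 (m q : ℕ) (hm : 4 ≤ m) (hm_even : Even m) (hq : q = 2 ^ m)
    {F K : Type*} [Field F] [Field K] [Algebra F K]
    (hF : Nat.card F = q) (hK : Nat.card K = q ^ 2) :
    TraceCodeDesign.IsMinWeight
        (TraceCodeDesign.traceCode F (TraceCodeDesign.code35 q K)) (q - 4) ∧
    60 ∣ (q - 4) * (q - 5) * (q - 6) ∧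
    TraceCodeDesign.IsDesign 3 (q + 1) (q - 4) ((q - 4) * (q - 5) * (q - 6) / 60)
        (TraceCodeDesign.supportBlocks
          (TraceCodeDesign.traceCode F (TraceCodeDesign.code35 q K)) (q - 4)) ∧
    TraceCodeDesign.IsDesign 3 (q + 1) 5 1
        (TraceCodeDesign.complementBlocks (TraceCodeDesign.supportBlocks
          (TraceCodeDesign.traceCode F (TraceCodeDesign.code35 q K)) (q - 4))) := by
  classical
  have hq16 : 16 ≤ q := by
    rw [hq]; exact (show 16 = 2 ^ 4 by norm_num) ▸ Nat.pow_le_pow_right (by norm_num) hm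
  have : Finite K := Nat.finite_of_card_ne_zero (by rw [hK]; positivity)
  have : CharP K 2 := TraceCodeDesign.charP_two_of_natCard_eq_two_pow (n := m * 2)
    (by rw [hK, hq, pow_mul])
  have h3 : 3 ∣ q - 1 := hq ▸ TraceCodeDesign.three_dvd_two_pow_sub_one hm_even
  have hσ : ∀ x : K, iterateFrobenius K 2 m x = x ^ q := fun x => by
    rw [iterateFrobenius_def, hq]
  have hcard : Fintype.card (rootsOfUnity (q + 1) K) = q + 1 := by
    rw [← Nat.card_eq_fintype_card, TraceCodeDesign.natCard_rootsOfUnity_of_natCard_eq_sq hK]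
  have hmem := TraceCodeDesign.mem_complementBlocks_supportBlocks_iff
    (TraceCodeDesign.traceCode F (TraceCodeDesign.code35 q K)) (k := 5) (w := q - 4)
    (by rw [hcard]; omega) (by omega)
  have hsteiner : TraceCodeDesign.IsDesign 3 (q + 1) 5 1
      (TraceCodeDesign.complementBlocks (TraceCodeDesign.supportBlocks
        (TraceCodeDesign.traceCode F (TraceCodeDesign.code35 q K)) (q - 4))) := by
    refine ⟨hcard, fun B hB => ((hmem B).1 hB).1, one_pos, fun T hT => ?_⟩
    obtain ⟨B, hB, huniq⟩ := TraceCodeDesign.existsUnique_zeros_superset (F := F)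
      (by omega) hF hK h3 hσ hT
    rw [Set.ncard_eq_one]
    refine ⟨B, Set.eq_singleton_iff_unique_mem.2 ⟨⟨(hmem B).2 hB.1, hB.2⟩, ?_⟩⟩
    rintro B' ⟨hB', hTB'⟩
    exact huniq B' ⟨(hmem B').1 hB', hTB'⟩
  have hdesign := TraceCodeDesign.isDesign_of_isDesign_complementBlocks (k := q - 4)
    (by omega) (by omega) (fun B hB => by
      obtain ⟨c, -, hc, rfl⟩ := hB
      exact hc) hsteiner
  rw [show q - 4 - 1 = q - 5 by omega, show q - 4 - 2 = q - 6 by omega] at hdesign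
  refine ⟨⟨?_, ?_⟩, hdesign.1, hdesign.2, hsteiner⟩
  -- Weight q - 4 is attained because λ > 0 provides a block.
  · obtain ⟨T, -, hT⟩ := Finset.exists_subset_card_eq
      (show 3 ≤ (Finset.univ : Finset (rootsOfUnity (q + 1) K)).card by
        rw [Finset.card_univ, hcard]; omega)
    have hne : {B ∈ TraceCodeDesign.supportBlocks (TraceCodeDesign.traceCode F
        (TraceCodeDesign.code35 q K)) (q - 4) | T ⊆ B}.ncard ≠ 0 := by
      rw [hdesign.2.card_blocks_through T hT]
      exact hdesign.2.lam_pos.ne'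
    obtain ⟨B, ⟨c, hc, hw, -⟩, -⟩ := Set.nonempty_of_ncard_ne_zero hne
    refine ⟨c, hc, ?_, hw⟩
    rintro rfl
    simp [TraceCodeDesign.wt] at hw
    omega
  · rintro w ⟨c, hc, hc0, rfl⟩
    have h5 := TraceCodeDesign.card_le_five_of_mem_traceCode (by omega) hF hK hσ hc hc0
      (TraceCodeDesign.supp c)ᶜ (by simp [TraceCodeDesign.supp])
    rw [Finset.card_compl, hcard] at h5
    change q - 4 ≤ (TraceCodeDesign.supp c).card
    omega
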